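/- Let $\phi=\frac{1+\sqrt5}{2}$ and let $a,b$ be labelled prototiles on the line, with supports $[0,\phi]$ and $[0,1]$; tiles are translates of prototiles. Let $F_0(a)=a$, $F_0(b)=b$, $F_{k+1}(a)=F_k(a)F_k(b)$, $F_{k+1}(b)=F_k(a)$ be the Fibonacci supertiles (words in $a,b$). Let $N(1)<N(2)<\cdots$ be positive integers with $N(n)-N(n-1)>2$ for all $n\ge 2$, put $N(0)=0$ and $k_n=N(n)-N(n-1)$. Define supertiles $E_n(a),E_n(b)$ for $n\ge 0$, and $E_n(e)$ for odd $n$, as follows. $E_0(a)=a$, $E_0(b)=b$. For $n$ odd, $E_n(a)$ and $E_n(b)$ are obtained by substituting $E_{n-1}(a),E_{n-1}(b)$ for the letters $a,b$ in the words $F_{k_n}(a)$ and $F_{k_n}(b)$ respectively, and $E_n(e)$ is obtained in the same way from the word $F_{k_n}(b)$ rearranged so that all its letters $a$ precede all its letters $b$. For $n\ge2$ even, $E_n(a)$ and $E_n(b)$ are obtained by substituting $E_{n-1}(a),E_{n-1}(b)$ for the letters in $F_{k_n}(a)$ and $F_{k_n}(b)$ respectively, except that one (arbitrarily chosen) copy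 of $E_{n-1}(b)$ is replaced by $E_{n-1}(e)$ in each of the two. The scrambled Fibonacci fusion $\mathcal S$ is the fusion rule with supertiles $S_m(a)=E_{2m}(a)$, $S_m(b)=E_{2m}(b)$, $m\ge0$. Let $X_{\mathcal S}$ be the space of all tilings of $\mathbb R$ by translates of $a,b$ each of whose patches (finite collections of tiles with connected union) has a translate contained in some $S_m(a)$ or $S_m(b)$. Give it the "big ball" topology: two tilings are $\varepsilon$-close if, after translating each by at most $\varepsilon$, they agree exactly on the ball of radius $1/\varepsilon$ around $0$. If $\lim_{n\to\infty}\bigl(N(2n+1)-2N(2n)\bigr)=+\infty$, then $X_{\mathcal S}$ is topologically weakly mixing: if $\alpha\in\mathbb R$ and there is a continuous $f:X_{\mathcal S}\to S^1=\{z\in\mathbb C:|z|=1\}$ with $f(T-v)=e^{2\pi i\alpha v}f(T)$ for all $T\in X_{\mathcal S}$ and $v\in\mathbb R$, then $\alpha=0$. -/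

import Mathlib

/-! ## One-dimensional tilings and the big ball topology -/

/-- A tile of the line: a prototile label together with the position of its left endpoint. -/
structure Tile (P : Type) where
  label : P
  pos : ℝ

namespace Tile

variable {P : Type}

/-- The closed interval covered by a tile, where the prototile `p` is `[0, ℓ p]`. -/
def support (ℓ : P → ℝ) (t : Tile P) : Set ℝ := Set.Icc t.pos (t.pos + ℓ t.label)

/-- The translated tile `t + v`. -/
def translate (v : ℝ) (t : Tile P) : Tile P := ⟨t.label, t.pos + v⟩

end Tile

/-- The translate `T + v` of a collection of tiles. -/
def translateTiles {P : Type} (v : ℝ) (T : Set (Tile P)) : Set (Tile P) :=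
  Tile.translate v '' T

/-- A tiling of the line: a collection of tiles covering `ℝ`, any two of which overlap only on
their boundaries. -/
structure IsTiling {P : Type} (ℓ : P → ℝ) (T : Set (Tile P)) : Prop where
  covers : ⋃ t ∈ T, t.support ℓ = Set.univ
  disjoint : ∀ t ∈ T, ∀ t' ∈ T, t ≠ t' →
    Disjoint (interior (t.support ℓ)) (interior (t'.support ℓ))

/-- A patch: a finite collection of tiles that overlap only on their boundaries and whose union is
connected. -/
structure IsPatch {P : Type} (ℓ : P → ℝ) (Q : Set (Tile P)) : Prop where
  finite : Q.Finite
  connected : IsConnected (⋃ t ∈ Q, t.support ℓ)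
  disjoint : ∀ t ∈ Q, ∀ t' ∈ Q, t ≠ t' →
    Disjoint (interior (t.support ℓ)) (interior (t'.support ℓ))

/-- The space of all tilings of the line by translates of the prototiles `[0, ℓ p]`. -/
def Tiling {P : Type} (ℓ : P → ℝ) : Type := {T : Set (Tile P) // IsTiling ℓ T}

theorem mem_translateTiles {P : Type} {v : ℝ} {T : Set (Tile P)} {t : Tile P} :
    t ∈ translateTiles v T ↔ t.translate (-v) ∈ T := by
  constructor
  · rintro ⟨s, hs, rfl⟩
    simpa [Tile.translate] using hs
  · intro h
    exact ⟨_, h, by simp [Tile.translate]⟩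

theorem translateTiles_add {P : Type} (v w : ℝ) (T : Set (Tile P)) :
    translateTiles v (translateTiles w T) = translateTiles (w + v) T := by
  ext t
  simp [mem_translateTiles, Tile.translate, add_assoc, add_comm]

theorem translateTiles_zero {P : Type} (T : Set (Tile P)) : translateTiles 0 T = T := by
  ext t
  simp [mem_translateTiles, Tile.translate]

theorem Tile.mem_support_translate {P : Type} {ℓ : P → ℝ} {v x : ℝ} {t : Tile P} :
    x ∈ (t.translate v).support ℓ ↔ x - v ∈ t.support ℓ := by
  simp only [Tile.translate, Tile.support, Set.mem_Icc]
  constructor <;> rintro ⟨h1, h2⟩ <;> constructor <;> linarith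

theorem Tile.interior_support {P : Type} (ℓ : P → ℝ) (t : Tile P) :
    interior (t.support ℓ) = Set.Ioo t.pos (t.pos + ℓ t.label) := interior_Icc

theorem disjoint_interior_translate {P : Type} {ℓ : P → ℝ} {v : ℝ} {s t : Tile P}
    (h : Disjoint (interior (s.support ℓ)) (interior (t.support ℓ))) :
    Disjoint (interior ((s.translate v).support ℓ)) (interior ((t.translate v).support ℓ)) := by
  rw [Set.disjoint_left] at h ⊢
  intro x hx hx'
  rw [Tile.interior_support] at hx hx'
  simp only [Tile.translate, Set.mem_Ioo] at hx hx'
  refine @h (x - v) ?_ ?_ <;> rw [Tile.interior_support] <;> constructor <;> linarith [hx.1, hx.2, hx'.1, hx'.2]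

theorem IsTiling.translate {P : Type} {ℓ : P → ℝ} {T : Set (Tile P)} (hT : IsTiling ℓ T) (v : ℝ) :
    IsTiling ℓ (translateTiles v T) where
  covers := by
    ext x
    have hx : x - v ∈ ⋃ t ∈ T, t.support ℓ := by rw [hT.covers]; trivial
    simp only [Set.mem_iUnion, exists_prop] at hx
    obtain ⟨t, ht, hxt⟩ := hx
    simp only [Set.mem_iUnion, exists_prop, Set.mem_univ, iff_true]
    exact ⟨_, ⟨t, ht, rfl⟩, Tile.mem_support_translate.2 hxt⟩
  disjoint := by
    rintro _ ⟨s, hs, rfl⟩ _ ⟨t, ht, rfl⟩ hne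
    exact disjoint_interior_translate (hT.disjoint s hs t ht fun h => hne (by rw [h]))

theorem IsPatch.translate {P : Type} {ℓ : P → ℝ} {Q : Set (Tile P)} (hQ : IsPatch ℓ Q) (v : ℝ) :
    IsPatch ℓ (translateTiles v Q) where
  finite := hQ.finite.image _
  connected := by
    have h : (⋃ t ∈ translateTiles v Q, t.support ℓ) = (fun x => x + v) '' ⋃ t ∈ Q, t.support ℓ := by
      ext x
      simp only [Set.mem_iUnion, exists_prop, Set.mem_image]
      constructor
      · rintro ⟨_, ⟨t, ht, rfl⟩, hx⟩
        exact ⟨x - v, ⟨t, ht, Tile.mem_support_translate.1 hx⟩, by ring⟩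
      · rintro ⟨y, ⟨t, ht, hy⟩, rfl⟩
        exact ⟨_, ⟨t, ht, rfl⟩, Tile.mem_support_translate.2 (by simpa using hy)⟩
    rw [h]
    exact hQ.connected.image _ (by fun_prop)
  disjoint := by
    rintro _ ⟨s, hs, rfl⟩ _ ⟨t, ht, rfl⟩ hne
    exact disjoint_interior_translate (hQ.disjoint s hs t ht fun h => hne (by rw [h]))

/-- The tiles of `T` that meet the closed ball of radius `r` around the origin. -/
def ballPatch {P : Type} (ℓ : P → ℝ) (T : Set (Tile P)) (r : ℝ) : Set (Tile P) :=
  {t ∈ T | (t.support ℓ ∩ Metric.closedBall 0 r).Nonempty}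

/-- Two collections of tiles are `ε`-close if, after translations of size at most `ε`, they agree
exactly on the ball of radius `1 / ε` around the origin. -/
def BigBallClose {P : Type} (ℓ : P → ℝ) (ε : ℝ) (T₁ T₂ : Set (Tile P)) : Prop :=
  ∃ g₁ g₂ : ℝ, |g₁| ≤ ε ∧ |g₂| ≤ ε ∧
    ballPatch ℓ (translateTiles g₁ T₁) (1 / ε) = ballPatch ℓ (translateTiles g₂ T₂) (1 / ε)

theorem ballPatch_congr {P : Type} {ℓ : P → ℝ} {T₁ T₂ : Set (Tile P)} {r s h : ℝ}
    (hr : s + |h| ≤ r) (H : ballPatch ℓ T₁ r = ballPatch ℓ T₂ r) :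
    ballPatch ℓ (translateTiles h T₁) s = ballPatch ℓ (translateTiles h T₂) s := by
  have key : ∀ {A B : Set (Tile P)}, ballPatch ℓ A r = ballPatch ℓ B r →
      ballPatch ℓ (translateTiles h A) s ⊆ ballPatch ℓ (translateTiles h B) s := by
    rintro A B hAB _ ⟨⟨t, ht, rfl⟩, x, hx, hxs⟩
    have hmem : t ∈ ballPatch ℓ A r := by
      refine ⟨ht, x - h, Tile.mem_support_translate.1 hx, ?_⟩
      rw [mem_closedBall_zero_iff, Real.norm_eq_abs] at hxs ⊢
      exact (abs_sub x h).trans (by linarith)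
    rw [hAB] at hmem
    exact ⟨⟨t, hmem.1, rfl⟩, x, hx, hxs⟩
  exact (key H).antisymm (key H.symm)

theorem BigBallClose.refl {P : Type} {ℓ : P → ℝ} {ε : ℝ} (hε : 0 < ε) (T : Set (Tile P)) :
    BigBallClose ℓ ε T T := ⟨0, 0, by simpa using hε.le, by simpa using hε.le, rfl⟩

theorem BigBallClose.symm {P : Type} {ℓ : P → ℝ} {ε : ℝ} {T₁ T₂ : Set (Tile P)}
    (h : BigBallClose ℓ ε T₁ T₂) : BigBallClose ℓ ε T₂ T₁ := by
  obtain ⟨g₁, g₂, h₁, h₂, h⟩ := h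
  exact ⟨g₂, g₁, h₂, h₁, h.symm⟩

theorem BigBallClose.mono {P : Type} {ℓ : P → ℝ} {δ ε : ℝ} (hδ : 0 < δ) (hδε : δ ≤ ε)
    {T₁ T₂ : Set (Tile P)} (h : BigBallClose ℓ δ T₁ T₂) : BigBallClose ℓ ε T₁ T₂ := by
  obtain ⟨g₁, g₂, h₁, h₂, h⟩ := h
  refine ⟨g₁, g₂, h₁.trans hδε, h₂.trans hδε, ?_⟩
  have := ballPatch_congr (h := 0) (s := 1 / ε) (r := 1 / δ)
    (by simpa using inv_anti₀ hδ hδε) h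
  simpa only [translateTiles_zero] using this

theorem BigBallClose.trans {P : Type} {ℓ : P → ℝ} {δ : ℝ} (hδ : 0 < δ) (hδ1 : δ ≤ 1 / 2)
    {T₁ T₂ T₃ : Set (Tile P)} (h : BigBallClose ℓ δ T₁ T₂) (h' : BigBallClose ℓ δ T₂ T₃) :
    BigBallClose ℓ (2 * δ) T₁ T₃ := by
  obtain ⟨g₁, g₂, h₁, h₂, h⟩ := h
  obtain ⟨k₂, k₃, h₃, h₄, h'⟩ := h'
  have hr : ∀ x : ℝ, |x| ≤ δ → 1 / (2 * δ) + |x| ≤ 1 / δ := by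
    intro x hx
    have e : 1 / δ = 1 / (2 * δ) + 1 / (2 * δ) := by field_simp; norm_num
    have : δ ≤ 1 / (2 * δ) := by
      rw [le_div_iff₀ (by positivity)]
      nlinarith
    linarith
  refine ⟨g₁ + k₂, k₃ + g₂, ?_, ?_, ?_⟩
  · exact (abs_add_le _ _).trans (by linarith)
  · exact (abs_add_le _ _).trans (by linarith)
  · have e₁ := ballPatch_congr (h := k₂) (s := 1 / (2 * δ)) (hr _ h₃) h
    have e₂ := ballPatch_congr (h := g₂) (s := 1 / (2 * δ)) (hr _ h₂) h'
    simp only [translateTiles_add] at e₁ e₂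
    rw [e₁, ← e₂, add_comm g₂ k₂]

/-- The pairs of `ε`-close tilings. -/
def bigBallEntourage {P : Type} (ℓ : P → ℝ) (ε : ℝ) : Set (Tiling ℓ × Tiling ℓ) :=
  {p | BigBallClose ℓ ε p.1.1 p.2.1}

theorem bigBallEntourage_mono {P : Type} (ℓ : P → ℝ) {δ ε : ℝ} (hδ : 0 < δ) (h : δ ≤ ε) :
    bigBallEntourage ℓ δ ⊆ bigBallEntourage ℓ ε := fun _ hp => hp.mono hδ h

/-- The big ball uniformity (and topology) on tilings: the sets of `ε`-close pairs, `ε > 0`, form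
a basis of entourages. -/
instance {P : Type} (ℓ : P → ℝ) : UniformSpace (Tiling ℓ) :=
  UniformSpace.ofCore <| UniformSpace.Core.mkOfBasis
    { sets := {U | ∃ ε : ℝ, 0 < ε ∧ U = bigBallEntourage ℓ ε}
      nonempty := ⟨_, 1, one_pos, rfl⟩
      inter_sets := by
        rintro _ _ ⟨ε, hε, rfl⟩ ⟨δ, hδ, rfl⟩
        have h : 0 < min ε δ := lt_min hε hδ
        exact ⟨_, ⟨_, h, rfl⟩, Set.subset_inter
          (bigBallEntourage_mono ℓ h (min_le_left _ _))
          (bigBallEntourage_mono ℓ h (min_le_right _ _))⟩ }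
    (by
      rintro _ ⟨ε, hε, rfl⟩ T
      exact BigBallClose.refl hε _)
    (by
      rintro _ ⟨ε, hε, rfl⟩
      exact ⟨_, ⟨ε, hε, rfl⟩, fun _ hp => BigBallClose.symm hp⟩)
    (by
      rintro _ ⟨ε, hε, rfl⟩
      have h : 0 < min ε 1 / 2 := by positivity
      refine ⟨_, ⟨_, h, rfl⟩, ?_⟩
      rintro ⟨T₁, T₃⟩ ⟨T₂, h₁₂, h₂₃⟩
      exact (BigBallClose.trans h (by linarith [min_le_right ε 1]) h₁₂ h₂₃).mono
        (by positivity) (by linarith [min_le_left ε 1]))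

/-! ## Fusion rules and their tiling spaces -/

/-- A one-dimensional prototile-regular fusion rule with prototile labels `P`: `comp n p` lists,
from left to right, the types of the `n`-supertiles that are fused into the `(n+1)`-supertile of
type `p`. -/
structure FusionRule (P : Type) where
  comp : ℕ → P → List P
  comp_ne_nil : ∀ n p, comp n p ≠ []

namespace FusionRule

variable {P : Type}

/-- The `n`-supertile of type `p`, as a word in the prototiles. -/
def supertile (R : FusionRule P) : ℕ → P → List P
  | 0, p => [p]
  | n + 1, p => (R.comp n p).flatMap (R.supertile n)

end FusionRule

/-- The tiles obtained by laying out the word `w` from left to right, starting at `x`. -/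
def wordTiles {P : Type} (ℓ : P → ℝ) : ℝ → List P → Set (Tile P)
  | _, [] => ∅
  | x, p :: w => insert ⟨p, x⟩ (wordTiles ℓ (x + ℓ p) w)

namespace FusionRule

variable {P : Type}

/-- A patch is admitted if a copy (translate) of it is found inside some supertile. -/
def Admits (R : FusionRule P) (ℓ : P → ℝ) (Q : Set (Tile P)) : Prop :=
  ∃ (n : ℕ) (p : P) (v : ℝ), translateTiles v Q ⊆ wordTiles ℓ 0 (R.supertile n p)

/-- The fusion tiling space: tilings all of whose patches are admitted. -/
def tilingSpace (R : FusionRule P) (ℓ : P → ℝ) : Set (Tiling ℓ) :=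
  {T | ∀ Q ⊆ T.1, IsPatch ℓ Q → R.Admits ℓ Q}

theorem translate_mem (R : FusionRule P) (ℓ : P → ℝ) (T : Tiling ℓ) (hT : T ∈ R.tilingSpace ℓ)
    (v : ℝ) : (⟨translateTiles v T.1, T.2.translate v⟩ : Tiling ℓ) ∈ R.tilingSpace ℓ := by
  intro Q hQ hP
  obtain ⟨n, p, w, h⟩ := hT (translateTiles (-v) Q)
    (by
      rintro _ ⟨t, ht, rfl⟩
      exact mem_translateTiles.1 (hQ ht)) (hP.translate _)
  exact ⟨n, p, -v + w, by rwa [translateTiles_add] at h⟩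

/-- The translation `T ↦ T - v` on the tiling space. -/
def shift (R : FusionRule P) (ℓ : P → ℝ) (v : ℝ) (T : R.tilingSpace ℓ) : R.tilingSpace ℓ :=
  ⟨⟨translateTiles (-v) T.1.1, T.1.2.translate (-v)⟩, R.translate_mem ℓ T.1 T.2 (-v)⟩

/-- `α` is a topological eigenvalue if some continuous `f : X_R → S¹` satisfies
`f (T - v) = exp (2 π i α v) f T` for all `T` and `v`. -/
def IsTopologicalEigenvalue (R : FusionRule P) (ℓ : P → ℝ) (α : ℝ) : Prop :=
  ∃ f : R.tilingSpace ℓ → Circle, Continuous f ∧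
    ∀ (T : R.tilingSpace ℓ) (v : ℝ),
      f (R.shift ℓ v T) = Circle.exp (2 * Real.pi * (α * v)) * f T

/-- There are no nontrivial topological eigenvalues. -/
def TopologicallyWeaklyMixing (R : FusionRule P) (ℓ : P → ℝ) : Prop :=
  ∀ α : ℝ, R.IsTopologicalEigenvalue ℓ α → α = 0

end FusionRule

/-! ## The scrambled Fibonacci fusion -/

namespace Fib

/-- The prototile labels. -/
inductive Letter
  | a
  | b
  deriving DecidableEq

/-- The supertile types at odd levels of the exceptional fusion. -/
inductive OddLetter
  | a
  | b
  | e

/-- An ordinary type, seen as a type of supertile at an odd level. -/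
def Letter.toOdd : Letter → OddLetter
  | .a => .a
  | .b => .b

/-- The tile `a` has length the golden mean and `b` has length `1`. -/
noncomputable def length : Letter → ℝ
  | .a => Real.goldenRatio
  | .b => 1

/-- The Fibonacci supertiles `F_{n+1}(a) = F_n(a) F_n(b)`, `F_{n+1}(b) = F_n(a)`. -/
def word : ℕ → Letter → List Letter
  | 0, p => [p]
  | n + 1, .a => word n .a ++ word n .b
  | n + 1, .b => word n .a

/-- The word `F_k(p)` also describes how the Fibonacci `(m+k)`-supertile `F_{m+k}(p)` is built
from the `m`-supertiles. -/
theorem word_add (m : ℕ) : ∀ (k : ℕ) (p : Letter), word (m + k) p = (word k p).flatMap (word m)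
  | 0, p => by simp [word]
  | k + 1, .a => by simp [word, word_add m k]
  | k + 1, .b => by simp [word, word_add m k]

theorem word_ne_nil : ∀ (k : ℕ) (p : Letter), word k p ≠ []
  | 0, p => by simp [word]
  | k + 1, .a => by simp [word, word_ne_nil k]
  | k + 1, .b => by simp [word, word_ne_nil k]

/-- How the supertiles of types `a`, `b`, `e` at an odd level `n` are built from those at level
`n - 1`, where `k = N(n) - N(n-1)`: types `a` and `b` as in the accelerated Fibonacci fusion, type
`e` by permuting the constituents of type `b` so that all the `a` come before all the `b`. -/
def oddComp (k : ℕ) : OddLetter → List Letter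
  | .a => word k .a
  | .b => word k .b
  | .e => (word k .b).filter (fun p => p = .a) ++ (word k .b).filter (fun p => p = .b)

/-- How the supertile of type `p` at an even level `n` is built from those at level `n - 1`, where
`k = N(n) - N(n-1)`: as in the accelerated Fibonacci fusion, except that the entry at index `i`
is replaced with `e`. -/
def evenComp (k i : ℕ) (p : Letter) : List OddLetter := ((word k p).map Letter.toOdd).set i .e

theorem oddComp_ne_nil (k : ℕ) (q : OddLetter) : oddComp k q ≠ [] := by
  cases q with
  | a => exact word_ne_nil k _
  | b => exact word_ne_nil k _
  | e =>
    intro h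
    obtain ⟨h₁, h₂⟩ := List.append_eq_nil_iff.1 h
    rw [List.filter_eq_nil_iff] at h₁ h₂
    obtain ⟨p, hp⟩ := List.exists_mem_of_ne_nil _ (word_ne_nil k .b)
    cases p with
    | a => exact h₁ _ hp (by simp)
    | b => exact h₂ _ hp (by simp)

/-- The scrambled Fibonacci fusion: the exceptional fusion induced on even levels, so that the
`m`-supertiles are the exceptional `2m`-supertiles. The index `i m p` is the position, among the
`(2m+1)`-supertiles that constitute the exceptional `(2m+2)`-supertile of type `p`, of the copy of
type `b` that is replaced with type `e`. -/
def scrambled (N : ℕ → ℕ) (i : ℕ → Letter → ℕ) : FusionRule Letter where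
  comp m p := (evenComp (N (2 * m + 2) - N (2 * m + 1)) (i m p) p).flatMap
    (oddComp (N (2 * m + 1) - N (2 * m)))
  comp_ne_nil m p := by
    intro h
    rw [List.flatMap_eq_nil_iff] at h
    have hne : evenComp (N (2 * m + 2) - N (2 * m + 1)) (i m p) p ≠ [] := by
      simp [evenComp, word_ne_nil]
    obtain ⟨q, hq⟩ := List.exists_mem_of_ne_nil _ hne
    exact oddComp_ne_nil _ q (h q hq)

end Fib

/-! Write `φ` for the golden ratio and `‖x‖` for the distance from `x` to the nearest integer. Let
`T` be the union of nested supertiles `S_m(a)`. If a copy of `S_n(a)` occurs in `T` displaced by `v`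
from the nested one, then `T` and `T - v` agree on a large ball when `n` is large, so continuity of
the eigenfunction forces `exp(2πiαv)` to be near 1 (`exists_supertile_forall_dist_lt`).

Scrambling produces long arithmetic progressions of such `v`. The constituent `e` inside
`S_{m+1}(a)` is a run of copies of `S_m(a)` followed by a run of copies of `S_m(b)`, each run of
length comparable to `φ ^ (N(2m+1) - N(2m))`. Every copy contains `S_n(a)` at the same offset, and
the common difference is the length of `S_m(a)` or `S_m(b)`, that is `φ ^ (N(2m) + 1)` or `φ ^
N(2m)`. A progression of `r` terms staying near the integers has `‖difference‖ ≤ 1/r`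
(`exists_int_abs_sub_mul_le_one`), so `‖α φ ^ (N(2m)+1)‖` and `‖α φ ^ N(2m)‖` are `O(φ ^ (N(2m) -
N(2m+1)))`.

Descending with `φ ^ n = φ ^ (n+2) - φ ^ (n+1)` costs a factor `φ` per step
(`exists_int_abs_sub_le_of_goldenRatio_pow`). Hence `‖α‖` and `‖αφ‖` are `O(φ ^ (2N(2m) -
N(2m+1)))`, which tends to 0 by the limit hypothesis. So `α` and `αφ` are integers, and
irrationality of `φ` gives `α = 0`. -/

/-! ## Words laid out on the line -/

/-- The length of the interval covered by a word. -/
noncomputable def wordLength {P : Type} (ℓ : P → ℝ) (w : List P) : ℝ := (w.map ℓ).sum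

section Words

variable {P : Type} {ℓ : P → ℝ}

@[simp] theorem wordLength_nil : wordLength ℓ [] = 0 := rfl

@[simp] theorem wordLength_cons (p : P) (w : List P) :
    wordLength ℓ (p :: w) = ℓ p + wordLength ℓ w := by simp [wordLength]

@[simp] theorem wordLength_append (u v : List P) :
    wordLength ℓ (u ++ v) = wordLength ℓ u + wordLength ℓ v := by simp [wordLength]

theorem wordLength_flatMap {Q : Type} (g : P → List Q) (ℓ' : Q → ℝ) (c : ℝ)
    (h : ∀ p, wordLength ℓ' (g p) = c * ℓ p) (w : List P) :
    wordLength ℓ' (w.flatMap g) = c * wordLength ℓ w := by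
  induction w with
  | nil => simp
  | cons p w ih => simp [ih, h, mul_add]

theorem wordLength_nonneg (hℓ : ∀ p, 0 < ℓ p) (w : List P) : 0 ≤ wordLength ℓ w := by
  induction w with
  | nil => simp
  | cons p w ih => simpa using add_nonneg (hℓ p).le ih

theorem one_le_wordLength (hℓ : ∀ p, 1 ≤ ℓ p) {w : List P} (hw : w ≠ []) :
    1 ≤ wordLength ℓ w := by
  cases w with
  | nil => exact absurd rfl hw
  | cons p w =>
    have := wordLength_nonneg (fun p => one_pos.trans_le (hℓ p)) w
    have := hℓ p
    simp only [wordLength_cons]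
    linarith

theorem wordTiles_append (x : ℝ) (u v : List P) :
    wordTiles ℓ x (u ++ v) = wordTiles ℓ x u ∪ wordTiles ℓ (x + wordLength ℓ u) v := by
  induction u generalizing x with
  | nil => simp [wordTiles]
  | cons p u ih => simp [wordTiles, ih, Set.insert_union, add_assoc]

theorem wordTiles_subset_of_eq (x : ℝ) {w u v s : List P} (h : s = u ++ w ++ v) :
    wordTiles ℓ (x + wordLength ℓ u) w ⊆ wordTiles ℓ x s := by
  subst h
  rw [wordTiles_append, wordTiles_append]
  exact Set.subset_union_right.trans Set.subset_union_left

theorem translateTiles_wordTiles (v x : ℝ) (w : List P) :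
    translateTiles v (wordTiles ℓ x w) = wordTiles ℓ (x + v) w := by
  induction w generalizing x with
  | nil => simp [wordTiles, translateTiles]
  | cons p w ih =>
    have h := ih (x + ℓ p)
    simp only [translateTiles] at h
    simp only [wordTiles, translateTiles, Set.image_insert_eq, h, Tile.translate]
    rw [add_right_comm]

theorem bounds_of_mem_wordTiles (hℓ : ∀ p, 0 < ℓ p) {x : ℝ} {w : List P} {t : Tile P}
    (ht : t ∈ wordTiles ℓ x w) : x ≤ t.pos ∧ t.pos + ℓ t.label ≤ x + wordLength ℓ w := by
  induction w generalizing x with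
  | nil => exact ht.elim
  | cons p w ih =>
    have := wordLength_nonneg hℓ w
    have := hℓ p
    rw [wordLength_cons]
    rcases ht with rfl | ht
    · exact ⟨le_rfl, by simp only; linarith⟩
    · obtain ⟨h₁, h₂⟩ := ih ht
      exact ⟨by linarith, by linarith⟩

theorem exists_mem_support_of_mem_Ioo {x y : ℝ} {w : List P}
    (hy : y ∈ Set.Ioo x (x + wordLength ℓ w)) : ∃ t ∈ wordTiles ℓ x w, y ∈ t.support ℓ := by
  suffices ∀ x, x ≤ y → y < x + wordLength ℓ w → ∃ t ∈ wordTiles ℓ x w, y ∈ t.support ℓ from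
    this x hy.1.le hy.2
  clear hy x
  induction w with
  | nil => intro x h₁ h₂; simp at h₂; linarith
  | cons p w ih =>
    intro x h₁ h₂
    rw [wordLength_cons] at h₂
    rcases le_or_gt y (x + ℓ p) with h | h
    · exact ⟨⟨p, x⟩, Set.mem_insert _ _, h₁, h⟩
    · obtain ⟨t, ht, hyt⟩ := ih (x + ℓ p) h.le (by linarith)
      exact ⟨t, Set.mem_insert_of_mem _ ht, hyt⟩

theorem disjoint_interior_of_le {s t : Tile P} (h : s.pos + ℓ s.label ≤ t.pos) :
    Disjoint (interior (s.support ℓ)) (interior (t.support ℓ)) := by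
  rw [Tile.interior_support, Tile.interior_support, Set.disjoint_left]
  intro x hx hx'
  linarith [hx.2, hx'.1]

theorem disjoint_interior_of_mem_wordTiles (hℓ : ∀ p, 0 < ℓ p) {x : ℝ} {w : List P} {s t : Tile P}
    (hs : s ∈ wordTiles ℓ x w) (ht : t ∈ wordTiles ℓ x w) (hne : s ≠ t) :
    Disjoint (interior (s.support ℓ)) (interior (t.support ℓ)) := by
  induction w generalizing x with
  | nil => exact hs.elim
  | cons p w ih =>
    rcases hs with rfl | hs <;> rcases ht with rfl | ht
    · exact absurd rfl hne
    · exact disjoint_interior_of_le (bounds_of_mem_wordTiles hℓ ht).1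
    · exact (disjoint_interior_of_le (bounds_of_mem_wordTiles hℓ hs).1).symm
    · exact ih hs ht

/-- If a tiling contains a word covering a neighbourhood of a ball, the tiles that meet the ball
belong to that word. -/
theorem ballPatch_eq_of_wordTiles_subset (hℓ : ∀ p, 0 < ℓ p) {T : Set (Tile P)} (hT : IsTiling ℓ T)
    {x r : ℝ} {w : List P} (hw : wordTiles ℓ x w ⊆ T) (hx : x < -r) (hr : r < x + wordLength ℓ w) :
    ballPatch ℓ T r = ballPatch ℓ (wordTiles ℓ x w) r := by
  refine Set.Subset.antisymm ?_ fun t ht => ⟨hw ht.1, ht.2⟩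
  rintro t ⟨ht, y, hyt, hyr⟩
  refine ⟨?_, y, hyt, hyr⟩
  -- The tile `t` may touch the ball only at an endpoint. Supports are closures of their interiors,
  -- so the common point can be moved first into the interior of `t`, then also into the interior of
  -- a tile of the word; disjointness of interiors then identifies the two tiles.
  have hcl : ∀ s : Tile P, s.support ℓ = closure (interior (s.support ℓ)) := fun s => by
    rw [Tile.interior_support, closure_Ioo (by linarith [hℓ s.label])]
    rfl
  rw [mem_closedBall_zero_iff, Real.norm_eq_abs, abs_le] at hyr
  rw [hcl t] at hyt
  obtain ⟨z, hz, hzt⟩ := mem_closure_iff.1 hyt (Set.Ioo x (x + wordLength ℓ w)) isOpen_Ioo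
    ⟨by linarith [hyr.1], by linarith [hyr.2]⟩
  obtain ⟨s, hs, hzs⟩ := exists_mem_support_of_mem_Ioo hz
  rw [hcl s] at hzs
  obtain ⟨z', hz', hzs'⟩ := mem_closure_iff.1 hzs _ isOpen_interior hzt
  by_contra hn
  have hne : t ≠ s := fun h => hn (h ▸ hs)
  exact Set.disjoint_left.1 (hT.disjoint t ht s (hw hs) hne) hz' hzs'

theorem ballPatch_translate_eq (hℓ : ∀ p, 0 < ℓ p) {T : Set (Tile P)} (hT : IsTiling ℓ T)
    {x r v : ℝ} {w : List P} (hw : wordTiles ℓ x w ⊆ T) (hv : wordTiles ℓ (x + v) w ⊆ T)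
    (hx : x < -r) (hr : r < x + wordLength ℓ w) :
    ballPatch ℓ (translateTiles (-v) T) r = ballPatch ℓ T r := by
  rw [ballPatch_eq_of_wordTiles_subset hℓ hT hw hx hr]
  refine ballPatch_eq_of_wordTiles_subset hℓ (hT.translate _) ?_ hx hr
  have := Set.image_mono (f := Tile.translate (-v)) hv
  change translateTiles _ _ ⊆ translateTiles _ _ at this
  rwa [translateTiles_wordTiles, add_neg_cancel_right] at this

/-- The union of a nested sequence of words exhausting the line in both directions is a tiling. -/
theorem isTiling_iUnion_wordTiles (hℓ : ∀ p, 0 < ℓ p) (x : ℕ → ℝ) (w : ℕ → List P)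
    (hmono : Monotone fun m => wordTiles ℓ (x m) (w m)) (hx : ∀ m, x m ≤ -m)
    (hw : ∀ m : ℕ, (m : ℝ) ≤ x m + wordLength ℓ (w m)) :
    IsTiling ℓ (⋃ m, wordTiles ℓ (x m) (w m)) where
  covers := by
    refine Set.eq_univ_of_forall fun y => ?_
    obtain ⟨m, hm⟩ := exists_nat_gt |y|
    obtain ⟨h₁, h₂⟩ := abs_lt.1 hm
    obtain ⟨t, ht, hy⟩ := exists_mem_support_of_mem_Ioo (ℓ := ℓ) (x := x m) (y := y) (w := w m)
      ⟨(hx m).trans_lt h₁, h₂.trans_le (hw m)⟩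
    simp only [Set.mem_iUnion, exists_prop]
    exact ⟨t, ⟨m, ht⟩, hy⟩
  disjoint := by
    intro s hs t ht hne
    obtain ⟨i, hi⟩ := Set.mem_iUnion.1 hs
    obtain ⟨j, hj⟩ := Set.mem_iUnion.1 ht
    exact disjoint_interior_of_mem_wordTiles hℓ (hmono (le_max_left i j) hi)
      (hmono (le_max_right i j) hj) hne

theorem Tiling.exists_bigBallEntourage_subset {U : Set (Tiling ℓ × Tiling ℓ)}
    (hU : U ∈ uniformity (Tiling ℓ)) : ∃ ε : ℝ, 0 < ε ∧ bigBallEntourage ℓ ε ⊆ U := by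
  obtain ⟨_, ⟨ε, hε, rfl⟩, h⟩ := (FilterBasis.mem_filter_iff _).1 hU
  exact ⟨ε, hε, h⟩

end Words

theorem Circle.dist_eq_norm_coe_sub (z w : Circle) : dist z w = ‖(z : ℂ) - w‖ :=
  dist_eq_norm (z : ℂ) w

/-! ## Recurrence in fusion tilings -/

namespace FusionRule

variable {P : Type} {ℓ : P → ℝ}

/-- If the supertiles of type `p` occur in the interior of those of the next level, there is a
tiling in the fusion tiling space that is the union of a nested sequence of them. -/
theorem exists_nested_tiling (R : FusionRule P) (hℓ : ∀ p, 1 ≤ ℓ p) (p : P)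
    (h : ∀ m, ∃ u v, u ≠ [] ∧ v ≠ [] ∧ R.supertile (m + 1) p = u ++ R.supertile m p ++ v) :
    ∃ (T : R.tilingSpace ℓ) (x : ℕ → ℝ), (∀ m, wordTiles ℓ (x m) (R.supertile m p) ⊆ T.1.1) ∧
      (∀ m, x m ≤ -m) ∧ ∀ m : ℕ, (m : ℝ) ≤ x m + wordLength ℓ (R.supertile m p) := by
  choose u v hu hv huv using h
  -- Stage 0 starts at the origin, and each later stage starts further left by the length of its
  -- prefix `u`, so that the stages are nested. Tiles have length at least 1, so nonempty `u` and
  -- `v` extend both ends by at least 1 per stage.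
  set x : ℕ → ℝ := fun m => -∑ j ∈ Finset.range m, wordLength ℓ (u j) with hxdef
  have hpos : ∀ p, 0 < ℓ p := fun p => one_pos.trans_le (hℓ p)
  have hsucc : ∀ m, x m = x (m + 1) + wordLength ℓ (u m) := fun m => by
    simp [hxdef, Finset.sum_range_succ]
  have hmono : Monotone fun m => wordTiles ℓ (x m) (R.supertile m p) :=
    monotone_nat_of_le_succ fun m => by
      change wordTiles ℓ (x m) _ ⊆ _
      rw [hsucc m]
      exact wordTiles_subset_of_eq _ (huv m)
  have hx : ∀ m : ℕ, x m ≤ -m := by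
    intro m
    induction m with
    | zero => simp [hxdef]
    | succ m ih =>
      have := one_le_wordLength hℓ (hu m)
      have := hsucc m
      push_cast
      linarith
  have hw : ∀ m : ℕ, (m : ℝ) ≤ x m + wordLength ℓ (R.supertile m p) := by
    intro m
    induction m with
    | zero => simpa [hxdef] using wordLength_nonneg hpos _
    | succ m ih =>
      have := one_le_wordLength hℓ (hv m)
      have := hsucc m
      rw [huv m, wordLength_append, wordLength_append]
      push_cast
      linarith
  refine ⟨⟨⟨_, isTiling_iUnion_wordTiles hpos x _ hmono hx hw⟩, ?_⟩, x, ?_, hx, hw⟩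
  · intro Q hQ hP
    -- A patch is finite, hence already contained in one stage of the increasing union.
    obtain ⟨m, hm⟩ := Directed.exists_mem_subset_of_finset_subset_biUnion hmono.directed_le
      (s := hP.finite.toFinset) (by rwa [Set.Finite.coe_toFinset])
    rw [Set.Finite.coe_toFinset] at hm
    exact ⟨m, p, -x m, by
      have := Set.image_mono (f := Tile.translate (-x m)) hm
      change translateTiles _ _ ⊆ translateTiles _ _ at this
      rwa [translateTiles_wordTiles, add_neg_cancel] at this⟩
  · exact fun m => Set.subset_iUnion (fun m => wordTiles ℓ (x m) (R.supertile m p)) m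

/-- A continuous eigenfunction almost takes the same value at all return times to a large
supertile. -/
theorem exists_supertile_forall_dist_lt (R : FusionRule P) (hℓ : ∀ p, 0 < ℓ p) {p : P}
    {T : R.tilingSpace ℓ} {x : ℕ → ℝ} (hT : ∀ m, wordTiles ℓ (x m) (R.supertile m p) ⊆ T.1.1)
    (hx : ∀ m, x m ≤ -m) (hw : ∀ m : ℕ, (m : ℝ) ≤ x m + wordLength ℓ (R.supertile m p))
    {α : ℝ} {f : R.tilingSpace ℓ → Circle} (hf : Continuous f)
    (hα : ∀ (T : R.tilingSpace ℓ) (v : ℝ),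
      f (R.shift ℓ v T) = Circle.exp (2 * Real.pi * (α * v)) * f T)
    {ε : ℝ} (hε : 0 < ε) :
    ∃ n, ∀ y, wordTiles ℓ y (R.supertile n p) ⊆ T.1.1 →
      dist (Circle.exp (2 * Real.pi * (α * (y - x n)))) 1 < ε := by
  have hU : f ⁻¹' Metric.ball (f T) ε ∈ nhds T := hf.continuousAt (Metric.ball_mem_nhds _ hε)
  obtain ⟨V, hV, hVU⟩ := mem_nhds_subtype _ _ _ |>.1 hU
  obtain ⟨W, hW, hWV⟩ := UniformSpace.mem_nhds_iff.1 hV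
  obtain ⟨δ, hδ, hδW⟩ := Tiling.exists_bigBallEntourage_subset hW
  obtain ⟨n, hn⟩ := exists_nat_gt (1 / δ)
  refine ⟨n, fun y hy => ?_⟩
  have hclose : (T.1, (R.shift ℓ (y - x n) T).1) ∈ bigBallEntourage ℓ δ := by
    -- The agreement is exact: the two copies of the `n`-supertile coincide after the shift and
    -- cover `[-n, n]`, with `n > 1 / δ`.
    refine ⟨0, 0, by simpa using hδ.le, by simpa using hδ.le, ?_⟩
    rw [translateTiles_zero, translateTiles_zero]
    refine (ballPatch_translate_eq hℓ T.1.2 (hT n) ?_ ?_ ?_).symm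
    · rwa [add_sub_cancel]
    · linarith [hx n]
    · linarith [hw n]
  have hmem := hVU (a := R.shift ℓ (y - x n) T) (hWV (hδW hclose))
  rw [Set.mem_preimage, Metric.mem_ball, hα] at hmem
  rw [Circle.dist_eq_norm_coe_sub, Circle.coe_mul, ← sub_one_mul, norm_mul, Circle.norm_coe,
    mul_one] at hmem
  rwa [Circle.dist_eq_norm_coe_sub]

end FusionRule

/-! ## Multiples of a real number close to integers -/

/-- The chord from 1 to `exp(2πis)` has length `2 |sin(πt)|`, where `t = s - round s` and `|t| ≤
1/2`. Jordan's inequality bounds it below by `4 |t|`. -/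
theorem abs_sub_round_lt_of_dist_circleExp {s : ℝ}
    (h : dist (Circle.exp (2 * Real.pi * s)) 1 < 1) : |s - round s| < 1 / 4 := by
  have hs := abs_sub_round s
  set t := s - round s with ht
  have hst : Circle.exp (2 * Real.pi * s) = Circle.exp (Real.pi * t * 2) := by
    rw [show 2 * Real.pi * s = Real.pi * t * 2 + round s * (2 * Real.pi) by rw [ht]; ring,
      Circle.exp_add, mul_comm (round s : ℝ), Circle.exp_two_pi_mul_int, mul_one]
  have hsin := Real.mul_abs_le_abs_sin (x := Real.pi * t) (by
    rw [abs_mul, abs_of_pos Real.pi_pos]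
    nlinarith [Real.pi_pos])
  rw [abs_mul, abs_of_pos Real.pi_pos, ← mul_assoc, div_mul_cancel₀ _ Real.pi_ne_zero] at hsin
  rw [hst, Circle.dist_eq_norm_coe_sub, Circle.coe_exp, Circle.coe_one, mul_comm _ Complex.I,
    Complex.norm_exp_I_mul_ofReal_sub_one, norm_mul, Real.norm_eq_abs, Real.norm_eq_abs, abs_two,
    mul_div_cancel_right₀ _ two_ne_zero] at h
  linarith

/-- If the first `r` terms of an arithmetic progression are close to integers, then the common
difference is within `1 / r` of an integer. -/
theorem exists_int_abs_sub_mul_le_one {c θ : ℝ} {r : ℕ}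
    (h : ∀ j < r, dist (Circle.exp (2 * Real.pi * (c + j * θ))) 1 < 1 / 2) :
    ∃ q : ℤ, |θ - q| * r ≤ 1 := by
  -- Comparison with the term `j = 0` removes `c`; the two errors of 1/2 add up to the threshold 1
  -- of the chord estimate.
  have hmul : ∀ j < r, |j * θ - round (j * θ)| < 1 / 4 := fun j hj => by
    refine abs_sub_round_lt_of_dist_circleExp ?_
    have h₀ := h 0 (by omega)
    rw [Nat.cast_zero, zero_mul, add_zero, dist_comm] at h₀
    have h₁ := (dist_triangle _ _ _).trans_lt (add_lt_add (h j hj) h₀)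
    rw [mul_add, Circle.exp_add, Circle.dist_eq_norm_coe_sub, Circle.coe_mul, ← mul_sub_one,
      norm_mul, Circle.norm_coe, one_mul] at h₁
    rw [Circle.dist_eq_norm_coe_sub]
    exact h₁.trans_eq (by norm_num)
  refine ⟨round θ, ?_⟩
  have ht := abs_sub_round θ
  set t := θ - round θ with htdef
  -- There is no wrap-around: from `|j t| < 1/4` and `|t| < 1/4` follows `|(j+1) t| < 1/2`, so the
  -- integer within 1/4 of `(j+1) t` has absolute value below 1 and must be 0.
  have key : ∀ j < r, |j * t| < 1 / 4 := by
    intro j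
    induction j with
    | zero => simp
    | succ j ih =>
      intro hj
      have h₁ : |t| < 1 / 4 := by simpa using hmul 1 (by omega)
      have h₂ := ih (by omega)
      have h₃ := hmul (j + 1) hj
      set n := round (((j + 1 : ℕ) : ℝ) * θ)
      have e : ((j + 1 : ℕ) : ℝ) * θ - n = ((j + 1 : ℕ) : ℝ) * t - (n - (j + 1) * round θ : ℤ) := by
        rw [htdef]; push_cast; ring
      rw [e] at h₃
      have h₄ : |((j + 1 : ℕ) : ℝ) * t| < 1 / 2 := by
        rw [show ((j + 1 : ℕ) : ℝ) * t = j * t + t by push_cast; ring]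
        exact (abs_add_le _ _).trans_lt (by linarith)
      have h₅ : (n - (j + 1) * round θ : ℤ) = 0 := by
        rw [← Int.abs_lt_one_iff]
        have : |((n - (j + 1) * round θ : ℤ) : ℝ)| < 1 := by
          rw [abs_lt] at *
          constructor <;> linarith
        exact_mod_cast this
      simpa [h₅] using h₃
  rcases r with _ | r
  · simp
  -- The last index only controls `r |t| < 1/4` for a progression of `r + 1` terms; the missing
  -- `|t|` is at most 1/2 by rounding.
  · have := key r (by omega)
    rw [abs_mul, Nat.abs_cast] at this
    push_cast
    linarith

theorem exists_int_eq_of_forall_abs_sub_le {β c φ : ℝ} (hφ : 1 < φ)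
    (h : ∀ n : ℕ, ∃ q : ℤ, |β - q| ≤ c / φ ^ n) : ∃ q : ℤ, β = q := by
  refine ⟨round β, sub_eq_zero.1 (abs_nonpos_iff.1 ?_)⟩
  refine ge_of_tendsto' (tendsto_const_nhds.div_atTop (tendsto_pow_atTop_atTop_of_one_lt hφ))
    (b := |β - round β|) (f := fun n : ℕ => c / φ ^ n) fun n => ?_
  obtain ⟨q, hq⟩ := h n
  exact (round_le β q).trans hq

open Real in
/-- Distances from `α φ ^ n` to the integers grow by a factor of at most `φ` as `n` decreases. -/
theorem exists_int_abs_sub_le_of_goldenRatio_pow (α : ℝ) (M : ℕ) {D : ℝ}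
    (h₀ : ∃ q : ℤ, |α * goldenRatio ^ M - q| ≤ goldenRatio * D)
    (h₁ : ∃ q : ℤ, |α * goldenRatio ^ (M + 1) - q| ≤ D) :
    (∃ q : ℤ, |α - q| ≤ goldenRatio ^ (M + 1) * D) ∧
      ∃ q : ℤ, |α * goldenRatio - q| ≤ goldenRatio ^ M * D := by
  induction M generalizing D with
  | zero => simpa using And.intro h₀ h₁
  | succ M ih =>
    obtain ⟨p, hp⟩ := h₀
    obtain ⟨q, hq⟩ := h₁
    -- The bounds `φ D` and `D` form a geometric pattern that reproduces itself with `φ D` for `D`,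
    -- because the new error `D + φ D` equals `φ ^ 2 D`.
    have := ih (D := goldenRatio * D) ⟨q - p, ?_⟩ ⟨p, hp⟩
    · simpa only [pow_succ, mul_assoc] using this
    · have e : α * goldenRatio ^ M - (q - p : ℤ) =
          (α * goldenRatio ^ (M + 1 + 1) - q) - (α * goldenRatio ^ (M + 1) - p) := by
        rw [← goldenRatio_pow_sub_goldenRatio_pow M]; push_cast; ring
      rw [e]
      refine (abs_sub _ _).trans ((add_le_add hq hp).trans_eq ?_)
      linear_combination (-D) * goldenRatio_sq

/-! ## Repeated words -/

section Words

variable {P : Type} {ℓ : P → ℝ}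

theorem exists_wordTiles_subset_of_isInfix {w s : List P} (h : w <:+: s) :
    ∃ d, ∀ x, wordTiles ℓ (x + d) w ⊆ wordTiles ℓ x s := by
  obtain ⟨u, v, h⟩ := h
  exact ⟨wordLength ℓ u, fun x => wordTiles_subset_of_eq x h.symm⟩

/-- This turns a run of equal supertiles into an arithmetic progression of occurrences of `w`: each
block `g q` contains `w` at the same offset, and consecutive blocks differ by the length of `g q`.
-/
theorem exists_wordTiles_subset_of_replicate_isInfix {Q : Type} {g : Q → List P} {q : Q} {r : ℕ}
    {w s : List P} (hs : (List.replicate r q).flatMap g <:+: s) (hw : w <:+: g q) :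
    ∃ d, ∀ x, ∀ j < r, wordTiles ℓ (x + d + j * wordLength ℓ (g q)) w ⊆ wordTiles ℓ x s := by
  obtain ⟨d, hd⟩ := exists_wordTiles_subset_of_isInfix (ℓ := ℓ) hs
  obtain ⟨d', hd'⟩ := exists_wordTiles_subset_of_isInfix (ℓ := ℓ) hw
  refine ⟨d + d', fun x j hj => ?_⟩
  have hlen : wordLength ℓ ((List.replicate j q).flatMap g) = j * wordLength ℓ (g q) := by
    induction j with
    | zero => simp
    | succ j ih =>
      rw [List.replicate_succ, List.flatMap_cons, wordLength_append, ih (by omega)]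
      push_cast; ring
  have e : (List.replicate r q).flatMap g =
      (List.replicate j q).flatMap g ++ g q ++ (List.replicate (r - j - 1) q).flatMap g := by
    conv_lhs => rw [show r = j + 1 + (r - j - 1) by omega]
    rw [List.replicate_add, List.replicate_succ']
    simp
  have := wordTiles_subset_of_eq (ℓ := ℓ) (x + d) e
  rw [hlen] at this
  rw [show x + (d + d') + j * wordLength ℓ (g q) = x + d + j * wordLength ℓ (g q) + d' by ring]
  exact (hd' _).trans (this.trans (hd x))

end Words

theorem FusionRule.supertile_ne_nil {P : Type} (R : FusionRule P) (n : ℕ) (p : P) :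
    R.supertile n p ≠ [] := by
  induction n generalizing p with
  | zero => simp [supertile]
  | succ n ih =>
    obtain ⟨q, hq⟩ := List.exists_mem_of_ne_nil _ (R.comp_ne_nil n p)
    intro h
    exact ih q (List.flatMap_eq_nil_iff.1 h q hq)

/-! ## The scrambled Fibonacci fusion -/

namespace Fib

open Real

/-! ### Letter counts and lengths of Fibonacci words and their scramblings -/

theorem one_le_length (p : Letter) : 1 ≤ length p := by
  cases p
  · exact one_lt_goldenRatio.le
  · exact le_rfl

/-- The last clause is additive so that it covers `k = 0` without truncated subtraction. -/
theorem count_word (k : ℕ) :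
    (word k .a).count .a = Nat.fib (k + 1) ∧ (word k .b).count .a = Nat.fib k ∧
      (word k .a).count .b = Nat.fib k ∧ (word k .b).count .b + Nat.fib k = Nat.fib (k + 1) := by
  induction k with
  | zero => decide
  | succ k ih =>
    obtain ⟨h₁, h₂, h₃, h₄⟩ := ih
    refine ⟨?_, h₁, ?_, ?_⟩
    · rw [word, List.count_append, h₁, h₂, Nat.fib_add_two, add_comm]
    · rw [word, List.count_append, h₃, add_comm, h₄]
    · rw [word, h₃, Nat.fib_add_two]

/-- These two long runs are the effect of scrambling that drives the whole argument: their lengths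
grow like `φ ^ k`. -/
theorem oddComp_e (k : ℕ) : oddComp (k + 1) .e =
    List.replicate (Nat.fib (k + 1)) .a ++ List.replicate (Nat.fib k) .b := by
  rw [oddComp, List.filter_eq, List.filter_eq, (count_word (k + 1)).2.1, word, (count_word k).2.2.1]

theorem mem_oddComp (k : ℕ) (q : OddLetter) : Letter.a ∈ oddComp (k + 1) q := by
  have h₁ : Letter.a ∈ word (k + 1) .a :=
    List.count_pos_iff.1 (by rw [(count_word _).1]; exact Nat.fib_pos.2 (by omega))
  have h₂ : Letter.a ∈ word (k + 1) .b :=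
    List.count_pos_iff.1 (by rw [(count_word _).2.1]; exact Nat.fib_pos.2 (by omega))
  cases q with
  | a => exact h₁
  | b => exact h₂
  | e => simpa [oddComp] using h₂

theorem e_mem_evenComp {k i : ℕ} {p : Letter} (hi : (word k p)[i]? = some .b) :
    OddLetter.e ∈ evenComp k i p := by
  refine List.mem_set ?_ _
  rw [List.length_map]
  exact (List.getElem?_eq_some_iff.1 hi).1

/-- With three constituents, the second one is flanked on both sides, which lets the nested
supertiles grow in both directions. -/
theorem three_le_length_evenComp {k : ℕ} (hk : 2 ≤ k) (i : ℕ) :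
    3 ≤ (evenComp k i .a).length := by
  obtain ⟨k, rfl⟩ := Nat.exists_eq_add_of_le' hk
  have h₁ := List.length_pos_iff.2 (word_ne_nil k .a)
  have h₂ := List.length_pos_iff.2 (word_ne_nil k .b)
  simp only [evenComp, word, List.length_set, List.length_map, List.length_append]
  omega

theorem wordLength_word (k : ℕ) : wordLength length (word k .a) = goldenRatio ^ k * goldenRatio ∧
    wordLength length (word k .b) = goldenRatio ^ k := by
  induction k with
  | zero => simp [word, length]
  | succ k ih =>
    refine ⟨?_, by rw [word, ih.1, pow_succ]⟩
    rw [word, wordLength_append, ih.1, ih.2]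
    linear_combination (-goldenRatio ^ k) * goldenRatio_sq

/-- The length of a supertile of type `q`, relative to that of type `b` of the same level. -/
noncomputable def oddLength : OddLetter → ℝ
  | .a => goldenRatio
  | .b => 1
  | .e => 1

theorem wordLength_oddComp (k : ℕ) (q : OddLetter) :
    wordLength length (oddComp k q) = goldenRatio ^ k * oddLength q := by
  cases q with
  | a => exact (wordLength_word k).1
  | b => rw [oddLength, mul_one]; exact (wordLength_word k).2
  | e =>
    -- Type `e` only permutes the constituents of type `b`, so the lengths agree.
    have hperm : (oddComp k .e).Perm (word k .b) := by
      have := List.filter_append_perm (fun p : Letter => decide (p = .a)) (word k .b)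
      rw [oddComp]
      convert this using 5 with p
      cases p <;> rfl
    rw [oddLength, mul_one, ← (wordLength_word k).2]
    exact (hperm.map _).sum_eq

/-- The replaced entry is a `b`, and `e` has the same length as `b`, so the list of lengths is
unchanged by the replacement. -/
theorem wordLength_evenComp {k i : ℕ} {p : Letter} (hi : (word k p)[i]? = some .b) :
    wordLength oddLength (evenComp k i p) = goldenRatio ^ k * length p := by
  obtain ⟨hlt, hb⟩ := List.getElem?_eq_some_iff.1 hi
  have hmap : (evenComp k i p).map oddLength = (word k p).map length := by
    have hcomp : oddLength ∘ Letter.toOdd = length := by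
      funext p; cases p <;> rfl
    rw [evenComp, List.map_set, List.map_map, hcomp]
    have : oddLength .e = ((word k p).map length)[i]'(by simpa using hlt) := by
      simp [hb, oddLength, length]
    rw [this, List.set_getElem_self]
  rw [wordLength, hmap]
  cases p
  · exact (wordLength_word k).1
  · rw [length, mul_one]; exact (wordLength_word k).2

/-- Since `φ ^ (k+1) = φ F_{k+1} + F_k ≤ (φ + 1) F_{k+1}`, the constant only has to exceed `φ ^ 2 +
φ`, and `φ < 2` makes 6 enough. -/
theorem goldenRatio_pow_le_fib (k : ℕ) : goldenRatio ^ (k + 2) ≤ 6 * Nat.fib (k + 1) := by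
  have h₁ := goldenRatio_mul_fib_succ_add_fib k
  have h₂ : (Nat.fib k : ℝ) ≤ Nat.fib (k + 1) := by exact_mod_cast Nat.fib_le_fib_succ
  have h₃ : (0 : ℝ) ≤ Nat.fib (k + 1) := Nat.cast_nonneg _
  have h₄ := goldenRatio_lt_two
  have h₅ := goldenRatio_pos
  rw [pow_succ, ← h₁]
  nlinarith [mul_nonneg h₃ h₅.le, mul_nonneg h₃ (sub_nonneg.2 h₄.le)]

/-! ### Occurrences and lengths of scrambled supertiles -/

section Scrambled

variable {N : ℕ → ℕ} {i : ℕ → Letter → ℕ}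

/-- The hypothesis puts the index in range, so `e` really occurs; `List.set` beyond the end of a
list would change nothing. -/
theorem oddComp_isInfix_comp {m : ℕ} {p : Letter}
    (hi : (word (N (2 * m + 2) - N (2 * m + 1)) p)[i m p]? = some .b) :
    oddComp (N (2 * m + 1) - N (2 * m)) .e <:+: (scrambled N i).comp m p := by
  obtain ⟨s, t, h⟩ := List.append_of_mem (e_mem_evenComp hi)
  refine ⟨s.flatMap (oddComp (N (2 * m + 1) - N (2 * m))),
    t.flatMap (oddComp (N (2 * m + 1) - N (2 * m))), ?_⟩
  simp only [scrambled, h, List.flatMap_append, List.flatMap_cons, List.append_assoc]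

theorem flatMap_isInfix_supertile {m : ℕ} {p : Letter} {w : List Letter}
    (h : w <:+: (scrambled N i).comp m p) :
    w.flatMap ((scrambled N i).supertile m) <:+: (scrambled N i).supertile (m + 1) p := by
  obtain ⟨s, t, h⟩ := h
  refine ⟨s.flatMap ((scrambled N i).supertile m), t.flatMap ((scrambled N i).supertile m), ?_⟩
  rw [FusionRule.supertile, ← h, List.flatMap_append, List.flatMap_append]

/-- Going up one level, the `e` constituent always contains an `a`; higher levels contain some
supertile of the level below. Thus each block in a run of `m`-supertiles yields a return to
`S_n(a)`. -/
theorem supertile_a_isInfix_supertile (hN : ∀ n, N n < N (n + 1))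
    (hi : ∀ m p, (word (N (2 * m + 2) - N (2 * m + 1)) p)[i m p]? = some .b) {n m : ℕ}
    (hnm : n < m) (p : Letter) :
    (scrambled N i).supertile n .a <:+: (scrambled N i).supertile m p := by
  induction m, hnm using Nat.le_induction generalizing p with
  | base =>
    obtain ⟨k, hk⟩ := Nat.exists_eq_succ_of_ne_zero (Nat.sub_ne_zero_of_lt (hN (2 * n)))
    obtain ⟨s, t, h⟩ := List.append_of_mem (mem_oddComp k .e)
    have h₁ : [Letter.a] <:+: (scrambled N i).comp n p :=
      List.IsInfix.trans ⟨s, t, by rw [hk, Nat.succ_eq_add_one, h]; simp⟩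
        (oddComp_isInfix_comp (hi n p))
    simpa using flatMap_isInfix_supertile h₁
  | succ m _ ih =>
    obtain ⟨q, hq⟩ := List.exists_mem_of_ne_nil _ ((scrambled N i).comp_ne_nil m p)
    obtain ⟨s, t, h⟩ := List.append_of_mem hq
    have h₁ : [q] <:+: (scrambled N i).comp m p := ⟨s, t, by rw [h]; simp⟩
    exact (ih q).trans (by simpa using flatMap_isInfix_supertile h₁)

theorem supertile_succ_a_eq (hN : ∀ n, N n < N (n + 1)) {m : ℕ}
    (hm : N (2 * m + 1) + 2 ≤ N (2 * m + 2)) :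
    ∃ u v, u ≠ [] ∧ v ≠ [] ∧ (scrambled N i).supertile (m + 1) .a =
      u ++ (scrambled N i).supertile m .a ++ v := by
  obtain ⟨k, hk⟩ := Nat.exists_eq_succ_of_ne_zero (Nat.sub_ne_zero_of_lt (hN (2 * m)))
  have hlen := three_le_length_evenComp (k := N (2 * m + 2) - N (2 * m + 1)) (by omega) (i m .a)
  obtain ⟨q₁, q₂, q₃, l, hl⟩ : ∃ q₁ q₂ q₃ l,
      evenComp (N (2 * m + 2) - N (2 * m + 1)) (i m .a) .a = q₁ :: q₂ :: q₃ :: l := by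
    -- The copy of `S_m(a)` is taken inside the second odd constituent; the first and third make the
    -- two flanks nonempty.
    match evenComp (N (2 * m + 2) - N (2 * m + 1)) (i m .a) .a, hlen with
    | q₁ :: q₂ :: q₃ :: l, _ => exact ⟨q₁, q₂, q₃, l, rfl⟩
  obtain ⟨s, t, h⟩ := List.append_of_mem (mem_oddComp k q₂)
  have hne : ∀ w : List Letter, w ≠ [] → w.flatMap ((scrambled N i).supertile m) ≠ [] := by
    intro w hw hnil
    obtain ⟨q, hq⟩ := List.exists_mem_of_ne_nil _ hw
    exact (scrambled N i).supertile_ne_nil m q (List.flatMap_eq_nil_iff.1 hnil q hq)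
  refine ⟨(oddComp (k + 1) q₁ ++ s).flatMap _,
    (t ++ (oddComp (k + 1) q₃ ++ l.flatMap (oddComp (k + 1)))).flatMap _,
    hne _ (by simp [oddComp_ne_nil]), hne _ (by simp [oddComp_ne_nil]), ?_⟩
  have hcomp : (scrambled N i).comp m .a = oddComp (k + 1) q₁ ++ s ++ [.a] ++
      (t ++ (oddComp (k + 1) q₃ ++ l.flatMap (oddComp (k + 1)))) := by
    simp only [scrambled, hl, hk, Nat.succ_eq_add_one, List.flatMap_cons, h]
    simp
  rw [FusionRule.supertile, hcomp, List.flatMap_append, List.flatMap_append, List.flatMap_singleton]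

theorem wordLength_supertile (hN0 : N 0 = 0) (hN : ∀ n, N n < N (n + 1))
    (hi : ∀ m p, (word (N (2 * m + 2) - N (2 * m + 1)) p)[i m p]? = some .b) (m : ℕ) (p : Letter) :
    wordLength length ((scrambled N i).supertile m p) = goldenRatio ^ N (2 * m) * length p := by
  induction m generalizing p with
  | zero => simp [FusionRule.supertile, hN0]
  | succ m ih =>
    rw [FusionRule.supertile, wordLength_flatMap _ _ _ ih, scrambled,
      wordLength_flatMap _ _ _ (wordLength_oddComp _), wordLength_evenComp (hi m p), ← mul_assoc,
      ← mul_assoc, ← pow_add, ← pow_add]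
    congr 2
    have := hN (2 * m)
    have : N (2 * m + 1) < N (2 * m + 2) := hN _
    rw [show 2 * (m + 1) = 2 * m + 2 by ring]
    omega

/-- For an eigenvalue `α`, the products of `α` with the lengths of the supertiles are close to
integers. -/
theorem exists_int_abs_sub_mul_fib_le_one (hN0 : N 0 = 0) (hN1 : 0 < N 1)
    (hN : ∀ n, 1 ≤ n → N n + 2 < N (n + 1))
    (hi : ∀ m p, (word (N (2 * m + 2) - N (2 * m + 1)) p)[i m p]? = some .b) {α : ℝ}
    (hα : (scrambled N i).IsTopologicalEigenvalue length α) :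
    ∃ n, ∀ m > n, ∀ k, N (2 * m) + k + 1 = N (2 * m + 1) →
      (∃ q : ℤ, |α * (goldenRatio ^ N (2 * m) * length .a) - q| * Nat.fib (k + 1) ≤ 1) ∧
      ∃ q : ℤ, |α * (goldenRatio ^ N (2 * m) * length .b) - q| * Nat.fib k ≤ 1 := by
  have hlt : ∀ n, N n < N (n + 1) := by
    intro n
    rcases n with _ | n
    · rwa [hN0]
    · have := hN (n + 1) (by omega)
      omega
  obtain ⟨f, hf, hfα⟩ := hα
  obtain ⟨T, x, hT, hx, hw⟩ := (scrambled N i).exists_nested_tiling one_le_length .a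
    fun m => supertile_succ_a_eq (i := i) hlt (hN (2 * m + 1) (by omega)).le
  obtain ⟨n, hn⟩ := (scrambled N i).exists_supertile_forall_dist_lt
    (fun p => one_pos.trans_le (one_le_length p)) hT hx hw hf hfα one_half_pos
  refine ⟨n, fun m hm k hk => ?_⟩
  have key : ∀ (r : ℕ) (p : Letter), (List.replicate r p).flatMap ((scrambled N i).supertile m) <:+:
      (scrambled N i).supertile (m + 1) .a →
      ∃ q : ℤ, |α * (goldenRatio ^ N (2 * m) * length p) - q| * r ≤ 1 := by
    intro r p hr
    obtain ⟨d, hd⟩ := exists_wordTiles_subset_of_replicate_isInfix (ℓ := length) hr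
      (supertile_a_isInfix_supertile hlt hi hm p)
    -- The `j`-th block contains `S_n(a)` at `x (m + 1) + d + j * length`, and returns are measured
    -- from the reference copy at `x n`; the constant `c` collects everything independent of `j`.
    refine exists_int_abs_sub_mul_le_one (c := α * (x (m + 1) + d - x n)) fun j hj => ?_
    have := hn _ ((hd (x (m + 1)) j hj).trans (hT (m + 1)))
    rw [wordLength_supertile hN0 hlt hi] at this
    convert this using 4
    ring
  have hinf := oddComp_isInfix_comp (hi m .a)
  rw [show N (2 * m + 1) - N (2 * m) = k + 1 by omega, oddComp_e] at hinf
  exact ⟨key _ _ (flatMap_isInfix_supertile ((List.prefix_append _ _).isInfix.trans hinf)),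
    key _ _ (flatMap_isInfix_supertile ((List.suffix_append _ _).isInfix.trans hinf))⟩

end Scrambled

end Fib

/-! ### Conclusion: both `α` and `α φ` are integers -/

theorem mainTheorem6 (N : ℕ → ℕ) (hN0 : N 0 = 0) (hN1 : 0 < N 1)
    (hN : ∀ n : ℕ, 1 ≤ n → N n + 2 < N (n + 1))
    (i : ℕ → Fib.Letter → ℕ)
    (hi : ∀ (m : ℕ) (p : Fib.Letter),
      (Fib.word (N (2 * m + 2) - N (2 * m + 1)) p)[i m p]? = some Fib.Letter.b)
    (hlim : Filter.Tendsto (fun n : ℕ => (N (2 * n + 1) : ℤ) - 2 * (N (2 * n) : ℤ))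
      Filter.atTop Filter.atTop) :
    (Fib.scrambled N i).TopologicallyWeaklyMixing Fib.length := by
  intro α hα
  obtain ⟨n, hn⟩ := Fib.exists_int_abs_sub_mul_fib_le_one hN0 hN1 hN hi hα
  have hφ := Real.one_lt_goldenRatio
  have hφ₀ := Real.goldenRatio_pos
  have key : ∀ Z : ℕ, (∃ q : ℤ, |α - q| ≤ 6 / Real.goldenRatio ^ Z) ∧
      ∃ q : ℤ, |α * Real.goldenRatio - q| ≤ 6 / Real.goldenRatio ^ Z := by
    intro Z
    -- The margin 2 serves twice: it gives `N (2m+1) - N (2m) ≥ 2`, so that `k` below exists, and it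
    -- absorbs the extra factor `φ` in `φ ^ (N (2m) + 1)`.
    obtain ⟨m, hmZ, hmn⟩ := ((hlim.eventually_ge_atTop ((Z : ℤ) + 2)).and
      (Filter.eventually_gt_atTop n)).exists
    obtain ⟨k, hk⟩ : ∃ k, N (2 * m) + (k + 1) + 1 = N (2 * m + 1) :=
      ⟨N (2 * m + 1) - N (2 * m) - 2, by omega⟩
    obtain ⟨⟨q₁, h₁⟩, q₂, h₂⟩ := hn m hmn (k + 1) hk
    have hfib := Fib.goldenRatio_pow_le_fib k
    have hle : ∀ y : ℝ, 0 ≤ y → y * Nat.fib (k + 1) ≤ 1 → y ≤ 6 / Real.goldenRatio ^ (k + 2) := by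
      intro y hy h
      rw [le_div_iff₀ (by positivity)]
      nlinarith [mul_le_mul_of_nonneg_left hfib hy]
    -- The runs have lengths `fib (k + 2)` and `fib (k + 1)`; the first is weakened to the second so
    -- that one `D` bounds both errors.
    have h₁' := hle _ (abs_nonneg _) (le_trans (mul_le_mul_of_nonneg_left
      (by exact_mod_cast Nat.fib_le_fib_succ) (abs_nonneg _)) h₁)
    have h₂' := hle _ (abs_nonneg _) h₂
    rw [Fib.length, ← pow_succ] at h₁'
    rw [Fib.length, mul_one] at h₂'
    set D := 6 / Real.goldenRatio ^ (k + 2) with hD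
    have hD₀ : 0 < D := by positivity
    -- Here `k + 2 = N (2m+1) - N (2m)`, so the left side is `6 φ ^ (2 N (2m) + 1 - N (2m+1))`.
    have hbound : Real.goldenRatio ^ (N (2 * m) + 1) * D ≤ 6 / Real.goldenRatio ^ Z := by
      rw [hD, ← mul_div_assoc, div_le_div_iff₀ (by positivity) (by positivity), mul_comm _ (6 : ℝ),
        mul_assoc, ← pow_add]
      exact mul_le_mul_of_nonneg_left (pow_le_pow_right₀ hφ.le (by omega)) (by norm_num)
    obtain ⟨⟨p, hp⟩, q, hq⟩ := exists_int_abs_sub_le_of_goldenRatio_pow α (N (2 * m)) (D := D)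
      ⟨q₂, h₂'.trans (le_mul_of_one_le_left hD₀.le hφ.le)⟩ ⟨q₁, h₁'⟩
    exact ⟨⟨p, hp.trans hbound⟩, q, hq.trans (le_trans (mul_le_mul_of_nonneg_right
      (pow_le_pow_right₀ hφ.le (Nat.le_succ _)) hD₀.le) hbound)⟩
  obtain ⟨p, hp⟩ := exists_int_eq_of_forall_abs_sub_le hφ fun Z => (key Z).1
  obtain ⟨q, hq⟩ := exists_int_eq_of_forall_abs_sub_le hφ fun Z => (key Z).2
  by_contra hα₀
  -- With `p = α ≠ 0` and `q = α φ`, the quotient `q / p` would be a rational value of `φ`.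
  refine Real.goldenRatio_irrational ⟨(q : ℚ) / p, ?_⟩
  push_cast
  rw [← hp, ← hq, mul_div_cancel_left₀ _ hα₀]
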